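/- Let $\varphi_k$ ($k\in\mathbb N$, $0\in\mathbb N$) be the univariate Hermite functions: $\varphi_0(x)=\pi^{-1/4}e^{-x^2/2}$, $\varphi_{-1}\equiv 0$, $x\varphi_k=\sqrt{\tfrac{k+1}{2}}\,\varphi_{k+1}+\sqrt{\tfrac k2}\,\varphi_{k-1}$. For $S>0$ and $\mathbf k\in\mathbb N^N$ let $\varphi^S_{\mathbf k}(x)=\prod_{l=1}^N\sqrt S\,\varphi_{k_l}(Sx_l)$ be the stretched, $L^2(\mathbb R^N)$-normalized tensor-product Hermite functions ($S=1$ is the unstretched case), and let $$\mathcal K=\mathcal K(K)=\Big\{\mathbf k\in\mathbb N^N : \prod_{l=1}^N(1+k_l)\le K+1\Big\}$$ be the hyperbolically reduced index set. Let $\mathcal R=\mathcal R(R)\subseteq\{0,\dots,R\}^N$, let $L>0$, and let $W(\cdot,t)$ be a real potential. Let $$W^{\mathrm{pol}}(x,t)=\sum_{\mathbf r\in\mathcal R}\alpha_{\mathbf r}(t)\prod_{l=1}^N T_{r_l}(x_l/L)$$ ($T_r$ the Chebyshev polynomials of the first kind) be the polynomial of this form which interpolates $W(\cdot,t)$ at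 $|\mathcal R|$ points of the cube $[-L,L]^N$, for any choice of points for which this interpolation problem is uniquely solvable (for instance the product Chebyshev points when $\mathcal R=\{0,\dots,R\}^N$). Let $\mathcal W_{\mathcal K,\mathrm{pol}}(t)_{\mathbf j\mathbf k}=\int_{\mathbb R^N}\varphi^S_{\mathbf j}\,W^{\mathrm{pol}}(\cdot,t)\,\varphi^S_{\mathbf k}\,dx$, $\mathbf j,\mathbf k\in\mathcal K$, and let $\mathcal W^{\mathrm{GH}(K)}_{\mathcal K,\mathrm{pol}}(t)$ be the matrix obtained by replacing each integral by product Gauss–Hermite quadrature with $K+1$ nodes per direction: $\int F\,dx$ is replaced by $\sum_{\xi}\big(\prod_{l} S^{-1}w(\xi_l)e^{\xi_l^2}\big)F(\xi/S)$, where $\xi$ runs through the $N$-tuples of zeros of the Hermite polynomial $H_{K+1}$ and $w(\cdot)$ are the Gauss weights for the weight function $e^{-x^2}$ on $\mathbb R$. Put $r_{\max}=\max_l r_l$ and $$C(\mathcal R,W,L,t)=\sum_{\mathbf r\in\mathcal R}|\alpha_{\mathbf r}(t)|\,\tfrac14\,r_{\max}^2(r_{\max}-1)\binom{r_{\max}}{\lfloor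 r_{\max}/2-1\rfloor_+},\qquad a_+=\max(a,0).$$ **Theorem.** There is an absolute constant $c>0$, and for each $R\in\mathbb N$ a number $K_0=K_0(R)$, such that the following holds for all $N$, all $\mathcal R\subseteq\{0,\dots,R\}^N$, all $L$, interpolation points, $W$, $t$ as above, all $\beta\in\mathbb N$, all $K\ge K_0$ and all $S>0$ with $SL\ge\sqrt{2(K+1)}+1$. If $v\in\mathbb C^{|\mathcal K|}$ satisfies $|v_{\mathbf k}|\le A\prod_{l=1}^N\max(k_l,1)^{-\beta}$ for all $\mathbf k\in\mathcal K$, then for every $\mathbf j\in\mathcal K$ $$\Big|\Big(\big(\mathcal W_{\mathcal K,\mathrm{pol}}(t)-\mathcal W^{\mathrm{GH}(K)}_{\mathcal K,\mathrm{pol}}(t)\big)v\Big)_{\mathbf j}\Big|\le 2^\beta\,c\,A\,C(\mathcal R,W,L,t)\,K^{-\beta},$$ and the factor $2^\beta$ can be omitted if moreover $K\ge K_0\,\beta$. -/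

import Mathlib

open MeasureTheory

noncomputable section

namespace HermiteGalerkin

/-- The univariate Hermite functions `φ_k`, generated by `φ_0(x) = π^{-1/4} e^{-x²/2}` and
`x φ_k = √((k+1)/2) φ_{k+1} + √(k/2) φ_{k-1}` (with `φ_{-1} = 0`). -/
def hermiteFun : ℕ → ℝ → ℝ
  | 0, x => Real.pi ^ (-(1 / 4) : ℝ) * Real.exp (-x ^ 2 / 2)
  | 1, x => Real.sqrt 2 * x * (Real.pi ^ (-(1 / 4) : ℝ) * Real.exp (-x ^ 2 / 2))
  | k + 2, x =>
      Real.sqrt (2 / (k + 2)) * x * hermiteFun (k + 1) x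
        - Real.sqrt ((k + 1) / (k + 2)) * hermiteFun k x

/-- The classical (physicists') Hermite polynomials: `H_0 = 1`, `H_1 = 2x`,
`H_{k+2} = 2x H_{k+1} - 2(k+1) H_k`. -/
def hermitePoly : ℕ → Polynomial ℝ
  | 0 => 1
  | 1 => 2 * Polynomial.X
  | k + 2 => 2 * Polynomial.X * hermitePoly (k + 1) - 2 * ((k : Polynomial ℝ) + 1) * hermitePoly k

/-- The stretched tensor-product Hermite functions, normalized in `L²(ℝ^N)`:
`x ↦ ∏_l √S φ_{k_l}(S x_l)`. For `S = 1` these are the tensor-product Hermite functions. -/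
def basisFun {N : ℕ} (S : ℝ) (k : Fin N → ℕ) (x : Fin N → ℝ) : ℝ :=
  ∏ l, Real.sqrt S * hermiteFun (k l) (S * x l)

/-- The hyperbolically reduced index set `{k ∈ ℕ^N | ∏_l (1 + k_l) ≤ K + 1}`. Each of its members
has all components at most `K`, so the ambient finite box removes nothing. -/
def hyperbolicCross (N K : ℕ) : Finset (Fin N → ℕ) :=
  (Fintype.piFinset fun _ : Fin N => Finset.range (K + 1)).filter
    fun k => ∏ l, (1 + k l) ≤ K + 1

theorem mem_hyperbolicCross {N K : ℕ} {k : Fin N → ℕ} :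
    k ∈ hyperbolicCross N K ↔ ∏ l, (1 + k l) ≤ K + 1 := by
  simp only [hyperbolicCross, Finset.mem_filter, Fintype.mem_piFinset, Finset.mem_range,
    and_iff_right_iff_imp]
  intro h l
  have h1 : 1 + k l ≤ ∏ l, (1 + k l) :=
    Finset.single_le_prod' (f := fun l => 1 + k l) (fun i _ => by omega) (Finset.mem_univ l)
  omega

/-! Chebyshev interpolation on the cube `[-L, L]^N`. -/

/-- `T_r(x / L) = ∏_l T_{r_l}(x_l / L)`, Chebyshev polynomials of the first kind. -/
def chebProd {N : ℕ} (L : ℝ) (r : Fin N → ℕ) (x : Fin N → ℝ) : ℝ :=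
  ∏ l, (Polynomial.Chebyshev.T ℝ (r l)).eval (x l / L)

/-- The collocation matrix `(T_r(x_s / L))_{s, r}` of the nodes `x_s`, one node for each index
`s` of the polynomial index set `I`. -/
def collocation {N : ℕ} (L : ℝ) (I : Finset (Fin N → ℕ)) (node : I → Fin N → ℝ) :
    Matrix I I ℝ :=
  Matrix.of fun s r => chebProd L r.1 (node s)

/-- The coefficients `α_r` of the interpolant of `f` at the nodes with respect to the Chebyshev
basis `T_r(x / L)`, `r ∈ I`. -/
def chebCoeff {N : ℕ} (L : ℝ) (I : Finset (Fin N → ℕ)) (node : I → Fin N → ℝ)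
    (f : (Fin N → ℝ) → ℝ) : I → ℝ :=
  (collocation L I node)⁻¹.mulVec fun s => f (node s)

/-- The interpolation polynomial `∑_{r ∈ I} α_r T_r(x / L)`. -/
def chebInterp {N : ℕ} (L : ℝ) (I : Finset (Fin N → ℕ)) (node : I → Fin N → ℝ)
    (f : (Fin N → ℝ) → ℝ) (x : Fin N → ℝ) : ℝ :=
  ∑ r : I, chebCoeff L I node f r * chebProd L r.1 x

theorem chebInterp_node {N : ℕ} (L : ℝ) (I : Finset (Fin N → ℕ)) (node : I → Fin N → ℝ)
    (h : IsUnit (collocation L I node).det) (f : (Fin N → ℝ) → ℝ) (s : I) :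
    chebInterp L I node f (node s) = f (node s) := by
  have h1 : (collocation L I node).mulVec (chebCoeff L I node f) = fun s => f (node s) := by
    rw [chebCoeff, Matrix.mulVec_mulVec, Matrix.mul_nonsing_inv _ h, Matrix.one_mulVec]
  have h2 := congrFun h1 s
  simp only [Matrix.mulVec, dotProduct, collocation, Matrix.of_apply] at h2
  rw [← h2, chebInterp]
  exact Finset.sum_congr rfl fun r _ => mul_comm _ _

/-! Galerkin matrices, exact and by product Gauss–Hermite quadrature. -/

/-- The Galerkin matrix `(φ_j, P φ_k)` of a multiplication operator `P` over the
hyperbolically reduced index set. -/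
def galerkinMatrix {N : ℕ} (S : ℝ) (K : ℕ) (P : (Fin N → ℝ) → ℝ) :
    Matrix (hyperbolicCross N K) (hyperbolicCross N K) ℂ :=
  Matrix.of fun j k => ((∫ x : Fin N → ℝ, basisFun S j.1 x * P x * basisFun S k.1 x : ℝ) : ℂ)

/-- The Gauss–Hermite nodes: the zeros of `H_{M+1}`. -/
def ghNodes (M : ℕ) : Finset ℝ := (hermitePoly (M + 1)).roots.toFinset

/-- The Gauss–Hermite weight of the node `ξ` (for the weight function `e^{-x²}`): the integral of
the Lagrange basis polynomial of that node. -/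
def ghWeight (M : ℕ) (ξ : ℝ) : ℝ :=
  ∫ x : ℝ, (Lagrange.basis (ghNodes M) (fun y => y) ξ).eval x * Real.exp (-x ^ 2)

/-- The product Gauss–Hermite rule with `M + 1` nodes in each direction for the integral of `F`
over `ℝ^N`, adapted to basis functions stretched by `S`: nodes `ξ / S` and
weights `∏_l w(ξ_l) e^{ξ_l²} / S`. -/
def ghQuad {N : ℕ} (S : ℝ) (M : ℕ) (F : (Fin N → ℝ) → ℝ) : ℝ :=
  ∑ ξ ∈ Fintype.piFinset fun _ : Fin N => ghNodes M,
    (∏ l, ghWeight M (ξ l) * Real.exp (ξ l ^ 2) / S) * F fun l => ξ l / S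

/-- The approximation of the Galerkin matrix by product Gauss–Hermite quadrature with `K + 1`
nodes in each direction. -/
def ghGalerkinMatrix {N : ℕ} (S : ℝ) (K : ℕ) (P : (Fin N → ℝ) → ℝ) :
    Matrix (hyperbolicCross N K) (hyperbolicCross N K) ℂ :=
  Matrix.of fun j k =>
    ((ghQuad S K fun x => basisFun S j.1 x * P x * basisFun S k.1 x : ℝ) : ℂ)

/-- `r_max = max_l r_l`. -/
def rMax {N : ℕ} (r : Fin N → ℕ) : ℕ := Finset.univ.sup r

/-- The constant `∑_{r ∈ I} |α_r| · ¼ r_max² (r_max - 1) · binom(r_max, ⌊r_max / 2 - 1⌋₊)`.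
(The subtraction in `ℕ` truncates at zero, as the positive part requires.) -/
def quadConst {N : ℕ} (I : Finset (Fin N → ℕ)) (α : I → ℝ) : ℝ :=
  ∑ r : I, |α r| * ((1 / 4) * (rMax r.1 : ℝ) ^ 2 * ((rMax r.1 : ℝ) - 1)
    * (Nat.choose (rMax r.1) (rMax r.1 / 2 - 1) : ℝ))

end HermiteGalerkin

end

/-! Expanding the interpolant in Chebyshev products and factoring over coordinates reduces every
matrix entry to the univariate entries `entryPoly`. Gauss–Hermite quadrature with `K + 1` nodes is
exact up to degree `2K + 1` (`gaussInt_eq_gaussQuad`), so the contribution of `r` to the entry `(j,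
k)` can be wrong only if `j l + r l + k l ≥ 2K + 2` for some `l`. Then `j l` and `k l` lie within
`R` of `K`, and the hyperbolic cross forces all other components of `j` and `k` to vanish. At most
`rMax r - 1` such `k` remain (`card_inexactIndices_le`), and there the decay of `v` gives the power
`K ^ (-β)`.

The univariate entries are bounded by one, so nothing grows with `N`. At nodes of modulus at most `S
* L` the Chebyshev factor is at most one, and the normalized Hermite polynomials have discrete norm
one (`abs_gaussQuad_hermiteOrtho_le_one`). An exact entry is a quadrature entry with `K + R + 1`
nodes, and the `+ 1` in the hypothesis on `S * L` keeps these nodes in range too. Hence the two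
products differ by at most 2. -/

noncomputable section

namespace HermiteGalerkin

open Polynomial

/-! ### Gaussian integrals of polynomials -/

/-- The Gaussian moment functional `p ↦ ∫ p(x) e^{-x²} dx`. -/
def gaussInt (p : ℝ[X]) : ℝ := ∫ x : ℝ, p.eval x * Real.exp (-x ^ 2)

theorem integrable_eval_mul_exp (p : ℝ[X]) :
    Integrable fun x : ℝ => p.eval x * Real.exp (-x ^ 2) := by
  induction p using Polynomial.induction_on' with
  | add p q hp hq =>
    simp only [eval_add, add_mul]
    exact hp.add hq
  | monomial n a =>
    have h := integrable_rpow_mul_exp_neg_mul_sq (b := 1) one_pos (s := n)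
      (by have : (0 : ℝ) ≤ n := n.cast_nonneg
          linarith)
    simpa [mul_assoc] using h.const_mul a

theorem gaussInt_add (p q : ℝ[X]) : gaussInt (p + q) = gaussInt p + gaussInt q := by
  simp only [gaussInt, eval_add, add_mul]
  exact integral_add (integrable_eval_mul_exp p) (integrable_eval_mul_exp q)

theorem gaussInt_sub (p q : ℝ[X]) : gaussInt (p - q) = gaussInt p - gaussInt q := by
  simp only [gaussInt, eval_sub, sub_mul]
  exact integral_sub (integrable_eval_mul_exp p) (integrable_eval_mul_exp q)

theorem gaussInt_C_mul (a : ℝ) (p : ℝ[X]) : gaussInt (C a * p) = a * gaussInt p := by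
  simp only [gaussInt, eval_mul, eval_C, mul_assoc]
  exact integral_const_mul _ _

theorem gaussInt_sum {ι : Type*} (s : Finset ι) (p : ι → ℝ[X]) :
    gaussInt (∑ i ∈ s, p i) = ∑ i ∈ s, gaussInt (p i) := by
  simp only [gaussInt, eval_finsetSum, Finset.sum_mul]
  exact integral_finsetSum s fun i _ => integrable_eval_mul_exp (p i)

theorem gaussInt_one : gaussInt 1 = Real.sqrt Real.pi := by
  simpa [gaussInt] using integral_gaussian 1

/-- Integration by parts: the derivative of `p e^{-x²}` integrates to zero. -/
theorem gaussInt_derivative (p : ℝ[X]) : gaussInt (derivative p) = gaussInt (2 * X * p) := by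
  have h : gaussInt (derivative p - 2 * X * p) = 0 := by
    refine integral_eq_zero_of_hasDerivAt_of_integrable
      (f := fun x : ℝ => p.eval x * Real.exp (-x ^ 2)) (fun x => ?_)
      (integrable_eval_mul_exp _) (integrable_eval_mul_exp p)
    have h1 : HasDerivAt (fun x : ℝ => Real.exp (-x ^ 2)) (Real.exp (-x ^ 2) * (-(2 * x))) x := by
      simpa using ((hasDerivAt_pow 2 x).neg).exp
    refine ((p.hasDerivAt x).mul h1).congr_deriv ?_
    simp only [eval_sub, eval_mul, eval_X, eval_ofNat]
    ring
  rw [gaussInt_sub] at h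
  linarith

/-! ### Hermite polynomials: recursions, orthogonality, degree -/

/-- The induction must carry both formulas: the first follows from the previous instance of the
second, and the second uses both. -/
theorem hermitePoly_succ_and_derivative (n : ℕ) :
    hermitePoly (n + 1) = 2 * X * hermitePoly n - derivative (hermitePoly n) ∧
      derivative (hermitePoly (n + 1)) = 2 * ((n : ℝ[X]) + 1) * hermitePoly n := by
  induction n with
  | zero => simp [hermitePoly]
  | succ n ih =>
    have h1 : hermitePoly (n + 2) =
        2 * X * hermitePoly (n + 1) - 2 * ((n : ℝ[X]) + 1) * hermitePoly n := rfl
    refine ⟨by rw [h1, ih.2], ?_⟩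
    rw [h1]
    simp only [derivative_sub, derivative_mul, ih.2, derivative_X, derivative_natCast,
      derivative_add, derivative_one, derivative_ofNat]
    push_cast
    linear_combination (-2 * ((n : ℝ[X]) + 1)) * ih.1

theorem hermitePoly_succ (n : ℕ) :
    hermitePoly (n + 1) = 2 * X * hermitePoly n - derivative (hermitePoly n) :=
  (hermitePoly_succ_and_derivative n).1

theorem derivative_hermitePoly_succ (n : ℕ) :
    derivative (hermitePoly (n + 1)) = 2 * ((n : ℝ[X]) + 1) * hermitePoly n :=
  (hermitePoly_succ_and_derivative n).2

theorem gaussInt_mul_hermitePoly_succ (q : ℝ[X]) (n : ℕ) :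
    gaussInt (q * hermitePoly (n + 1)) = gaussInt (derivative q * hermitePoly n) := by
  have h := gaussInt_derivative (q * hermitePoly n)
  have e : q * hermitePoly (n + 1)
      = 2 * X * (q * hermitePoly n) - q * derivative (hermitePoly n) := by
    rw [hermitePoly_succ]
    ring
  rw [derivative_mul, gaussInt_add] at h
  rw [e, gaussInt_sub]
  linarith

/-- The raising operator `2X - d/dx` is the adjoint of differentiation; orthogonality to lower
degrees follows. -/
theorem gaussInt_mul_hermitePoly (n : ℕ) (q : ℝ[X]) :
    gaussInt (q * hermitePoly n) = gaussInt (derivative^[n] q) := by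
  induction n generalizing q with
  | zero => simp [hermitePoly]
  | succ n ih => rw [gaussInt_mul_hermitePoly_succ, ih, Function.iterate_succ_apply]

theorem gaussInt_mul_hermitePoly_eq_zero {n : ℕ} {q : ℝ[X]} (h : q.degree < n) :
    gaussInt (q * hermitePoly n) = 0 := by
  rcases eq_or_ne q 0 with rfl | hq
  · simp [gaussInt]
  rw [gaussInt_mul_hermitePoly,
    iterate_derivative_eq_zero ((natDegree_lt_iff_degree_lt hq).2 h)]
  simp [gaussInt]

theorem gaussInt_hermitePoly_sq_succ (n : ℕ) :
    gaussInt (hermitePoly (n + 1) ^ 2) = 2 * (n + 1) * gaussInt (hermitePoly n ^ 2) := by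
  rw [sq, gaussInt_mul_hermitePoly_succ, derivative_hermitePoly_succ, ← gaussInt_C_mul]
  congr 1
  simp only [C_mul, C_add, C_1, map_natCast, map_ofNat]
  ring

theorem natDegree_hermitePoly_le_and_coeff (n : ℕ) :
    (hermitePoly n).natDegree ≤ n ∧ (hermitePoly n).coeff n = 2 ^ n := by
  induction n with
  | zero => simp [hermitePoly]
  | succ n ih =>
    have e : hermitePoly (n + 1) = C 2 * (X * hermitePoly n) - derivative (hermitePoly n) := by
      rw [hermitePoly_succ, mul_assoc]
      rfl
    constructor
    · rw [e]
      refine (natDegree_sub_le _ _).trans (max_le ?_ ?_)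
      · refine (natDegree_C_mul_le _ _).trans (natDegree_mul_le.trans ?_)
        rw [natDegree_X]
        omega
      · exact (natDegree_derivative_le _).trans (by omega)
    · rw [e, coeff_sub, coeff_C_mul, coeff_X_mul, ih.2, coeff_derivative,
        coeff_eq_zero_of_natDegree_lt (by omega)]
      ring

theorem hermitePoly_ne_zero (n : ℕ) : hermitePoly n ≠ 0 := fun h => by
  have := (natDegree_hermitePoly_le_and_coeff n).2
  rw [h, coeff_zero] at this
  exact pow_ne_zero n two_ne_zero this.symm

theorem degree_hermitePoly (n : ℕ) : (hermitePoly n).degree = n := by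
  refine degree_eq_of_le_of_coeff_ne_zero
    (natDegree_le_iff_degree_le.1 (natDegree_hermitePoly_le_and_coeff n).1) ?_
  rw [(natDegree_hermitePoly_le_and_coeff n).2]
  positivity

theorem natDegree_hermitePoly (n : ℕ) : (hermitePoly n).natDegree = n :=
  natDegree_eq_of_degree_eq_some (degree_hermitePoly n)

/-! ### Normalized Hermite polynomials and Hermite functions -/

/-- The normalization factor `(2^k k! √π)^{-1/2}` of the Hermite functions. -/
def hermiteNorm : ℕ → ℝ
  | 0 => Real.pi ^ (-(1 / 4) : ℝ)
  | k + 1 => hermiteNorm k / Real.sqrt (2 * (k + 1))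

/-- The normalized Hermite polynomials. -/
def hermiteOrtho (k : ℕ) : ℝ[X] := C (hermiteNorm k) * hermitePoly k

theorem natDegree_hermiteOrtho_le (k : ℕ) : (hermiteOrtho k).natDegree ≤ k :=
  (natDegree_C_mul_le _ _).trans (natDegree_hermitePoly k).le

theorem gaussInt_hermiteOrtho_sq (k : ℕ) : gaussInt (hermiteOrtho k ^ 2) = 1 := by
  have e : ∀ k, gaussInt (hermiteOrtho k ^ 2) = hermiteNorm k ^ 2 * gaussInt (hermitePoly k ^ 2) := by
    intro k
    rw [hermiteOrtho, mul_pow, ← C_pow, gaussInt_C_mul]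
  rw [e]
  induction k with
  | zero =>
    have h : (Real.pi ^ (-(1 / 4) : ℝ)) ^ 2 = Real.pi ^ (-(1 / 2) : ℝ) := by
      rw [← Real.rpow_natCast, ← Real.rpow_mul Real.pi_pos.le]
      norm_num
    rw [hermiteNorm, hermitePoly, one_pow, gaussInt_one, h, Real.sqrt_eq_rpow,
      ← Real.rpow_add Real.pi_pos]
    norm_num
  | succ k ih =>
    rw [gaussInt_hermitePoly_sq_succ, hermiteNorm, div_pow, Real.sq_sqrt (by positivity)]
    field_simp
    exact ih

theorem hermiteFun_eq (k : ℕ) (x : ℝ) :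
    hermiteFun k x = (hermiteOrtho k).eval x * Real.exp (-x ^ 2 / 2) := by
  induction k using Nat.twoStepInduction with
  | zero => simp [hermiteFun, hermiteOrtho, hermitePoly, hermiteNorm]
  | one =>
    simp only [hermiteFun, hermiteOrtho, hermitePoly, hermiteNorm, eval_mul, eval_C, eval_X,
      eval_ofNat, Nat.cast_zero, zero_add, mul_one]
    field_simp
    rw [Real.sq_sqrt (by norm_num), mul_comm]
  | more k h0 h1 =>
    have hk : (0 : ℝ) ≤ k := k.cast_nonneg
    have e1 : hermiteNorm (k + 1) = hermiteNorm k / Real.sqrt (2 * (k + 1)) := rfl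
    have e2 : hermiteNorm (k + 2) = hermiteNorm (k + 1) / Real.sqrt (2 * (k + 2)) := by
      rw [hermiteNorm]
      push_cast
      ring_nf
    have s1 : Real.sqrt (2 / (k + 2)) = 2 / Real.sqrt (2 * (k + 2)) := by
      rw [Real.sqrt_eq_iff_mul_self_eq (by positivity) (by positivity), div_mul_div_comm,
        Real.mul_self_sqrt (by positivity)]
      field_simp
    have s2 : Real.sqrt ((k + 1) / (k + 2))
        = 2 * (k + 1) / (Real.sqrt (2 * (k + 1)) * Real.sqrt (2 * (k + 2))) := by
      rw [Real.sqrt_eq_iff_mul_self_eq (by positivity) (by positivity), div_mul_div_comm,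
        mul_mul_mul_comm (Real.sqrt _), Real.mul_self_sqrt (by positivity), Real.mul_self_sqrt (by positivity)]
      field_simp
    rw [hermiteFun, h0, h1, s1, s2]
    simp only [hermiteOrtho, hermitePoly, eval_mul, eval_C, eval_sub, eval_X, eval_ofNat,
      eval_add, eval_natCast, eval_one, e2]
    rw [e1]
    have p1 : Real.sqrt (2 * ((k : ℝ) + 1)) ≠ 0 := by positivity
    have p2 : Real.sqrt (2 * ((k : ℝ) + 2)) ≠ 0 := by positivity
    field_simp

/-! ### Zeros of the Hermite polynomials -/

theorem gaussInt_nonneg {p : ℝ[X]} (h : ∀ x, 0 ≤ p.eval x) : 0 ≤ gaussInt p :=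
  integral_nonneg fun x => mul_nonneg (h x) (Real.exp_pos _).le

theorem gaussInt_pos {p : ℝ[X]} (hp : p ≠ 0) (h : ∀ x, 0 ≤ p.eval x) : 0 < gaussInt p := by
  have hx : ∃ x, p.eval x ≠ 0 := by
    by_contra! hc
    exact hp (Polynomial.funext fun x => by simpa using hc x)
  obtain ⟨x, hx⟩ := hx
  exact integral_pos_of_integrable_nonneg_nonzero (x := x)
    (f := fun x : ℝ => p.eval x * Real.exp (-x ^ 2)) (by fun_prop) (integrable_eval_mul_exp p)
    (fun x => mul_nonneg (h x) (Real.exp_pos _).le) (mul_ne_zero hx (Real.exp_pos _).ne')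

/-- Two consecutive Hermite polynomials have no common zero. -/
theorem eval_hermitePoly_ne_zero_of_succ {n : ℕ} {x : ℝ} (h : (hermitePoly (n + 1)).eval x = 0) :
    (hermitePoly n).eval x ≠ 0 := by
  induction n with
  | zero => simp [hermitePoly]
  | succ n ih =>
    intro h0
    refine ih h0 ?_
    have hn : (n : ℝ) + 1 ≠ 0 := n.cast_add_one_ne_zero
    have h1 : (hermitePoly (n + 2)).eval x
        = 2 * x * (hermitePoly (n + 1)).eval x - 2 * (n + 1) * (hermitePoly n).eval x := by
      simp [hermitePoly]
    rw [h, h0] at h1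
    have h2 : ((n : ℝ) + 1) * (hermitePoly n).eval x = 0 := by linarith
    exact (mul_eq_zero.1 h2).resolve_left hn

theorem ghNodes_mem {M : ℕ} {ξ : ℝ} : ξ ∈ ghNodes M ↔ (hermitePoly (M + 1)).eval ξ = 0 := by
  rw [ghNodes, Multiset.mem_toFinset, mem_roots (hermitePoly_ne_zero _), IsRoot.def]

theorem hermitePoly_rootMultiplicity_le_one (n : ℕ) (x : ℝ) :
    (hermitePoly (n + 1)).rootMultiplicity x ≤ 1 := by
  by_contra! h
  have h1 := (one_lt_rootMultiplicity_iff_isRoot (hermitePoly_ne_zero (n + 1))).1 h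
  have h2 := h1.2
  rw [derivative_hermitePoly_succ, IsRoot.def] at h2
  have hn : (n : ℝ) + 1 ≠ 0 := n.cast_add_one_ne_zero
  simp only [eval_mul, eval_ofNat, eval_add, eval_natCast, eval_one] at h2
  exact eval_hermitePoly_ne_zero_of_succ h1.1
    ((mul_eq_zero.1 h2).resolve_left (mul_ne_zero two_ne_zero hn))

/-- `H_{M+1}` has `M + 1` distinct real zeros. -/
theorem card_ghNodes (M : ℕ) : (ghNodes M).card = M + 1 := by
  set H := hermitePoly (M + 1) with hH
  have hH0 : H ≠ 0 := hermitePoly_ne_zero _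
  have hnd : H.roots.Nodup := Multiset.nodup_iff_count_le_one.2 fun x => by
    rw [count_roots]
    exact hermitePoly_rootMultiplicity_le_one M x
  have hcard : (ghNodes M).card = H.roots.card := by
    rw [ghNodes, Multiset.toFinset_card_of_nodup hnd]
  have hle : H.roots.card ≤ M + 1 := (card_roots' H).trans (natDegree_hermitePoly _).le
  rw [hcard]
  refine le_antisymm hle (not_lt.1 fun hlt => ?_)
  -- With too few zeros, the product `q` of the linear factors has degree below `M + 1`, so `q` is
  -- orthogonal to `H = q * s`. But `s` has no real zero, so `q ^ 2 * s` has constant sign and a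
  -- nonzero integral.
  obtain ⟨s, hs, -, hs0⟩ := exists_prod_multiset_X_sub_C_mul H
  set q := (H.roots.map fun a => X - C a).prod with hq
  have hq0 : q ≠ 0 := fun h => hH0 (by rw [← hs, h, zero_mul])
  have hsne : s ≠ 0 := fun h => hH0 (by rw [← hs, h, mul_zero])
  have hs1 : ∀ x, s.eval x ≠ 0 := fun x hx => by
    have : x ∈ s.roots := (mem_roots hsne).2 hx
    rw [hs0] at this
    simp at this
  have hqd : q.degree < (M + 1 : ℕ) := by
    rw [degree_eq_natDegree hq0, hq, natDegree_multiset_prod_X_sub_C_eq_card]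
    exact_mod_cast hlt
  have horth := gaussInt_mul_hermitePoly_eq_zero hqd
  have hsq : q * hermitePoly (M + 1) = q ^ 2 * s := by
    rw [← hH, ← hs]
    ring
  rw [hsq] at horth
  have hne : q ^ 2 * s ≠ 0 := mul_ne_zero (pow_ne_zero 2 hq0) hsne
  have hsign : (∀ x, 0 < s.eval x) ∨ ∀ x, s.eval x < 0 := by
    by_contra! hc
    obtain ⟨⟨a, ha⟩, b, hb⟩ := hc
    obtain ⟨x, hx⟩ := mem_range_of_exists_le_of_exists_ge s.continuous ⟨a, ha⟩ ⟨b, hb⟩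
    exact hs1 x hx
  rcases hsign with h | h
  · refine (gaussInt_pos hne fun x => ?_).ne' horth
    rw [eval_mul, eval_pow]
    exact mul_nonneg (sq_nonneg _) (h x).le
  · refine (gaussInt_pos (neg_ne_zero.2 hne) fun x => ?_).ne' ?_
    · rw [eval_neg, eval_mul, eval_pow, neg_nonneg]
      exact mul_nonpos_of_nonneg_of_nonpos (sq_nonneg _) (h x).le
    · rw [← zero_sub, gaussInt_sub, horth]
      simp [gaussInt]

theorem eval_neg_hermitePoly (n : ℕ) (x : ℝ) :
    (hermitePoly n).eval (-x) = (-1) ^ n * (hermitePoly n).eval x := by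
  induction n using Nat.twoStepInduction with
  | zero => simp [hermitePoly]
  | one => simp [hermitePoly]
  | more n h0 h1 =>
    simp only [hermitePoly, eval_sub, eval_mul, eval_X, eval_ofNat, eval_add, eval_natCast,
      eval_one, h0, h1]
    ring

/-- In the three-term recursion the subtracted term `2(k+1) H_k` is at most `x² H_k ≤ x H_{k+1}`, so
the growth propagates. Thus `H_n` has no zero at any `x > 0` with `x² ≥ 2n`. -/
theorem hermitePoly_growth {n : ℕ} {x : ℝ} (hx : 0 < x) (hn : 2 * (n : ℝ) ≤ x ^ 2) :
    ∀ k ≤ n, 0 < (hermitePoly k).eval x ∧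
      x * (hermitePoly k).eval x ≤ (hermitePoly (k + 1)).eval x := by
  intro k
  induction k with
  | zero =>
    intro _
    simp only [hermitePoly, eval_mul, eval_X, eval_ofNat, eval_one]
    exact ⟨one_pos, by linarith⟩
  | succ k ih =>
    intro hk
    obtain ⟨h0, h1⟩ := ih (by omega)
    have hpos : 0 < (hermitePoly (k + 1)).eval x := (mul_pos hx h0).trans_le h1
    refine ⟨hpos, ?_⟩
    have e : (hermitePoly (k + 2)).eval x
        = 2 * x * (hermitePoly (k + 1)).eval x - 2 * (k + 1) * (hermitePoly k).eval x := by
      simp [hermitePoly]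
    have hk' : ((k : ℝ) + 1) ≤ n := by exact_mod_cast hk
    have h2 : 2 * ((k : ℝ) + 1) * (hermitePoly k).eval x ≤ x ^ 2 * (hermitePoly k).eval x :=
      mul_le_mul_of_nonneg_right (by linarith) h0.le
    have h3 : x * (x * (hermitePoly k).eval x) ≤ x * (hermitePoly (k + 1)).eval x :=
      mul_le_mul_of_nonneg_left h1 hx.le
    rw [e]
    linarith

theorem abs_ghNode_le {M : ℕ} {ξ : ℝ} (h : ξ ∈ ghNodes M) :
    |ξ| ≤ Real.sqrt (2 * ((M : ℝ) + 1)) := by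
  by_contra! hc
  have hpos : 0 < |ξ| := (Real.sqrt_nonneg _).trans_lt hc
  have hsq : 2 * ((M + 1 : ℕ) : ℝ) ≤ |ξ| ^ 2 := by
    have := (Real.sqrt_lt' hpos).1 hc
    push_cast
    exact this.le
  have h1 := (hermitePoly_growth hpos hsq (M + 1) le_rfl).1
  have h0 : (hermitePoly (M + 1)).eval ξ = 0 := ghNodes_mem.1 h
  rcases abs_choice ξ with e | e
  · rw [e, h0] at h1
    exact h1.false
  · rw [e, eval_neg_hermitePoly, h0, mul_zero] at h1
    exact h1.false

/-! ### Gauss quadrature -/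

/-- Gauss–Hermite quadrature with `M + 1` nodes. -/
def gaussQuad (M : ℕ) (p : ℝ[X]) : ℝ := ∑ ξ ∈ ghNodes M, ghWeight M ξ * p.eval ξ

theorem gaussInt_basis (M : ℕ) (ξ : ℝ) :
    gaussInt (Lagrange.basis (ghNodes M) (fun y => y) ξ) = ghWeight M ξ := rfl

/-- Gauss quadrature is exact up to degree `2M + 1`. -/
theorem gaussInt_eq_gaussQuad {M : ℕ} {p : ℝ[X]} (hp : p.natDegree ≤ 2 * M + 1) :
    gaussInt p = gaussQuad M p := by
  set H := hermitePoly (M + 1) with hH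
  have hH0 : H ≠ 0 := hermitePoly_ne_zero _
  have hdiv : p / H * H + p % H = p := by
    rw [mul_comm]
    exact EuclideanDomain.div_add_mod p H
  -- The quotient has degree at most `(2M + 1) - (M + 1) = M`, so it is orthogonal to `H`; the
  -- remainder is recovered by interpolation at the nodes.
  have hq : (p / H).degree < (M + 1 : ℕ) := by
    rcases lt_or_ge p.degree H.degree with h | h
    · rw [(Polynomial.div_eq_zero_iff hH0).2 h, degree_zero]
      exact WithBot.bot_lt_coe _
    · have hp0 : p ≠ 0 := fun h0 => by
        rw [h0, degree_zero, le_bot_iff, degree_eq_bot] at h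
        exact hH0 h
      have hadd := degree_add_div hH0 h
      have hd0 : p / H ≠ 0 := fun h0 => by
        rw [h0, degree_zero, WithBot.add_bot] at hadd
        exact hp0 (degree_eq_bot.1 hadd.symm)
      rw [degree_hermitePoly, degree_eq_natDegree hd0, degree_eq_natDegree hp0] at hadd
      rw [degree_eq_natDegree hd0]
      norm_cast at hadd ⊢
      omega
  have hr : (p % H).degree < (ghNodes M).card := by
    rw [card_ghNodes, ← degree_hermitePoly (M + 1)]
    exact degree_mod_lt p hH0
  have hint : gaussInt p = gaussInt (p % H) := by
    conv_lhs => rw [← hdiv]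
    rw [gaussInt_add, gaussInt_mul_hermitePoly_eq_zero hq, zero_add]
  rw [hint, Lagrange.eq_interpolate (s := ghNodes M) (v := fun y => y)
    (fun x _ y _ h => h) hr, Lagrange.interpolate_apply, gaussInt_sum, gaussQuad]
  refine Finset.sum_congr rfl fun ξ hξ => ?_
  have h0 : H.eval ξ = 0 := ghNodes_mem.1 hξ
  have he : (p % H).eval ξ = p.eval ξ := by
    conv_rhs => rw [← hdiv]
    rw [eval_add, eval_mul, h0, mul_zero, zero_add]
  rw [gaussInt_C_mul, gaussInt_basis, he, mul_comm]

/-- The squared Lagrange basis polynomial has degree `2M`, so its quadrature value, which is the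
weight, equals the integral of a square. -/
theorem ghWeight_nonneg {M : ℕ} {ξ : ℝ} (h : ξ ∈ ghNodes M) : 0 ≤ ghWeight M ξ := by
  have hinj : Set.InjOn (fun y : ℝ => y) (ghNodes M : Set ℝ) := fun x _ y _ h => h
  set l := Lagrange.basis (ghNodes M) (fun y => y) ξ with hl
  have hdeg : (l ^ 2).natDegree ≤ 2 * M + 1 := by
    refine natDegree_pow_le.trans ?_
    rw [hl, natDegree_eq_of_degree_eq_some (Lagrange.degree_basis hinj h), card_ghNodes]
    omega
  have hsum : gaussQuad M (l ^ 2) = ghWeight M ξ := by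
    rw [gaussQuad, Finset.sum_eq_single_of_mem ξ h]
    · rw [eval_pow, hl, Lagrange.eval_basis_self hinj h, one_pow, mul_one]
    · intro η hη hne
      rw [eval_pow, hl, Lagrange.eval_basis_of_ne (v := fun y : ℝ => y) hne.symm hη]
      simp
  rw [← hsum, ← gaussInt_eq_gaussQuad hdeg]
  exact gaussInt_nonneg fun x => by
    rw [eval_pow]
    exact sq_nonneg _

/-- A quadrature entry with a multiplier bounded by one at the nodes is bounded by one. -/
theorem abs_gaussQuad_hermiteOrtho_le_one {M j k : ℕ} (hj : j ≤ M) (hk : k ≤ M) {p : ℝ[X]}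
    (hp : ∀ ξ ∈ ghNodes M, |p.eval ξ| ≤ 1) :
    |gaussQuad M (hermiteOrtho j * p * hermiteOrtho k)| ≤ 1 := by
  -- Squares have degree at most `2M`, so exactness transfers the normalization to the discrete
  -- norm.
  have hnorm : ∀ i ≤ M, ∑ ξ ∈ ghNodes M, ghWeight M ξ * (hermiteOrtho i).eval ξ ^ 2 = 1 := by
    intro i hi
    have hd : (hermiteOrtho i ^ 2).natDegree ≤ 2 * M + 1 := by
      have := natDegree_pow_le (p := hermiteOrtho i) (n := 2)
      have := natDegree_hermiteOrtho_le i
      omega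
    rw [← gaussInt_hermiteOrtho_sq i, gaussInt_eq_gaussQuad hd]
    simp [gaussQuad]
  calc |gaussQuad M (hermiteOrtho j * p * hermiteOrtho k)|
      ≤ ∑ ξ ∈ ghNodes M,
          |ghWeight M ξ * (hermiteOrtho j * p * hermiteOrtho k).eval ξ| :=
        Finset.abs_sum_le_sum_abs _ _
    _ ≤ ∑ ξ ∈ ghNodes M, ghWeight M ξ *
          (((hermiteOrtho j).eval ξ ^ 2 + (hermiteOrtho k).eval ξ ^ 2) / 2) := by
        refine Finset.sum_le_sum fun ξ hξ => ?_
        rw [abs_mul, abs_of_nonneg (ghWeight_nonneg hξ)]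
        refine mul_le_mul_of_nonneg_left ?_ (ghWeight_nonneg hξ)
        rw [eval_mul, eval_mul, abs_mul, abs_mul, ← sq_abs (eval ξ (hermiteOrtho j)),
          ← sq_abs (eval ξ (hermiteOrtho k))]
        have h1 := mul_le_mul_of_nonneg_left (hp ξ hξ) (abs_nonneg (eval ξ (hermiteOrtho j)))
        have h2 := mul_le_mul_of_nonneg_right h1 (abs_nonneg (eval ξ (hermiteOrtho k)))
        have h3 := two_mul_le_add_sq |eval ξ (hermiteOrtho j)| |eval ξ (hermiteOrtho k)|
        linarith
    _ = 1 := by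
        simp only [mul_div_assoc', mul_add]
        rw [← Finset.sum_div, Finset.sum_add_distrib, hnorm j hj, hnorm k hk]
        norm_num

/-! ### Bounds for the univariate entries -/

/-- The polynomial `T_r(x / Λ)`. -/
def scaledCheb (Λ : ℝ) (r : ℕ) : ℝ[X] := (Chebyshev.T ℝ r).comp (C Λ⁻¹ * X)

theorem eval_scaledCheb (Λ : ℝ) (r : ℕ) (x : ℝ) :
    (scaledCheb Λ r).eval x = (Chebyshev.T ℝ r).eval (x / Λ) := by
  rw [scaledCheb, eval_comp, eval_mul, eval_C, eval_X, div_eq_inv_mul]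

theorem natDegree_scaledCheb_le (Λ : ℝ) (r : ℕ) : (scaledCheb Λ r).natDegree ≤ r := by
  refine natDegree_comp_le.trans ?_
  rw [Chebyshev.natDegree_T, Int.natAbs_natCast]
  calc r * (C Λ⁻¹ * X).natDegree ≤ r * 1 := Nat.mul_le_mul_left r ((natDegree_C_mul_le _ _).trans natDegree_X_le)
    _ = r := mul_one r

theorem abs_eval_scaledCheb_le_one {Λ x : ℝ} (r : ℕ) (hΛ : 0 < Λ) (hx : |x| ≤ Λ) :
    |(scaledCheb Λ r).eval x| ≤ 1 := by
  rw [eval_scaledCheb]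
  refine Chebyshev.abs_eval_T_real_le_one _ ?_
  rw [abs_div, abs_of_pos hΛ]
  exact (div_le_one hΛ).2 hx

/-- The polynomial part of the univariate integrand `φ_j T_r(x / Λ) φ_k`. -/
def entryPoly (Λ : ℝ) (r j k : ℕ) : ℝ[X] := hermiteOrtho j * scaledCheb Λ r * hermiteOrtho k

theorem natDegree_entryPoly_le (Λ : ℝ) (r j k : ℕ) :
    (entryPoly Λ r j k).natDegree ≤ j + r + k :=
  natDegree_mul_le.trans (add_le_add (natDegree_mul_le.trans
    (add_le_add (natDegree_hermiteOrtho_le j) (natDegree_scaledCheb_le Λ r)))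
    (natDegree_hermiteOrtho_le k))

theorem abs_gaussQuad_entryPoly_le_one {Λ : ℝ} {M r j k : ℕ} (hΛ : 0 < Λ)
    (hM : Real.sqrt (2 * ((M : ℝ) + 1)) ≤ Λ) (hj : j ≤ M) (hk : k ≤ M) :
    |gaussQuad M (entryPoly Λ r j k)| ≤ 1 :=
  abs_gaussQuad_hermiteOrtho_le_one hj hk fun _ hξ =>
    abs_eval_scaledCheb_le_one r hΛ ((abs_ghNode_le hξ).trans hM)

/-- With `a = √(2(K+1))`, the square of `a + 1` exceeds `a²` by `2a + 1`, and `a ≥ R` covers the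
increment `2R`. -/
theorem sqrt_two_mul_add_le {K R : ℕ} (h : R ^ 2 ≤ K) :
    Real.sqrt (2 * (((K + R : ℕ) : ℝ) + 1)) ≤ Real.sqrt (2 * ((K : ℝ) + 1)) + 1 := by
  have h1 : (R : ℝ) ≤ Real.sqrt (2 * ((K : ℝ) + 1)) := by
    refine Real.le_sqrt_of_sq_le ?_
    have : (R : ℝ) ^ 2 ≤ K := by exact_mod_cast h
    have : (0 : ℝ) ≤ K := K.cast_nonneg
    linarith
  have h2 : Real.sqrt (2 * ((K : ℝ) + 1)) ^ 2 = 2 * ((K : ℝ) + 1) := Real.sq_sqrt (by positivity)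
  rw [Real.sqrt_le_left (by positivity), add_sq, h2]
  push_cast
  linarith

/-- The exact univariate entries are quadrature entries of a larger rule, whence bounded by
one. -/
theorem abs_gaussInt_entryPoly_le_one {Λ : ℝ} {K R r j k : ℕ} (hR : R ^ 2 ≤ K)
    (hΛ : Real.sqrt (2 * ((K : ℝ) + 1)) + 1 ≤ Λ) (hr : r ≤ R) (hj : j ≤ K) (hk : k ≤ K) :
    |gaussInt (entryPoly Λ r j k)| ≤ 1 := by
  have hpos : 0 < Λ := by
    have := Real.sqrt_nonneg (2 * ((K : ℝ) + 1))
    linarith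
  rw [gaussInt_eq_gaussQuad (M := K + R)
    ((natDegree_entryPoly_le Λ r j k).trans (by omega))]
  exact abs_gaussQuad_entryPoly_le_one hpos ((sqrt_two_mul_add_le hR).trans hΛ) (by omega)
    (by omega)

/-! ### Factorization of the multivariate entries -/

theorem hermiteFun_mul_scaledCheb_mul (Λ : ℝ) (r j k : ℕ) (y : ℝ) :
    hermiteFun j y * (scaledCheb Λ r).eval y * hermiteFun k y
      = (entryPoly Λ r j k).eval y * Real.exp (-y ^ 2) := by
  have h : Real.exp (-y ^ 2) = Real.exp (-y ^ 2 / 2) * Real.exp (-y ^ 2 / 2) := by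
    rw [← Real.exp_add]
    congr 1
    ring
  rw [hermiteFun_eq, hermiteFun_eq, h, entryPoly, eval_mul, eval_mul]
  ring

theorem stretched_integrand {S L : ℝ} (hS : 0 < S) (r j k : ℕ) (x : ℝ) :
    (Real.sqrt S * hermiteFun j (S * x)) * (Chebyshev.T ℝ r).eval (x / L)
        * (Real.sqrt S * hermiteFun k (S * x))
      = S * ((entryPoly (S * L) r j k).eval (S * x) * Real.exp (-(S * x) ^ 2)) := by
  rw [← hermiteFun_mul_scaledCheb_mul, eval_scaledCheb, mul_div_mul_left _ _ hS.ne']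
  linear_combination (hermiteFun j (S * x) * (Chebyshev.T ℝ r).eval (x / L)
    * hermiteFun k (S * x)) * Real.mul_self_sqrt hS.le

theorem basisFun_mul_chebProd_mul {N : ℕ} {S L : ℝ} (hS : 0 < S) (r j k : Fin N → ℕ)
    (x : Fin N → ℝ) :
    basisFun S j x * chebProd L r x * basisFun S k x
      = ∏ l, S * ((entryPoly (S * L) (r l) (j l) (k l)).eval (S * x l)
          * Real.exp (-(S * x l) ^ 2)) := by
  rw [basisFun, chebProd, basisFun, ← Finset.prod_mul_distrib, ← Finset.prod_mul_distrib]
  exact Finset.prod_congr rfl fun l _ => stretched_integrand hS (r l) (j l) (k l) (x l)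

theorem integrable_basisFun_mul_chebProd_mul {N : ℕ} {S L : ℝ} (hS : 0 < S)
    (r j k : Fin N → ℕ) :
    Integrable fun x : Fin N → ℝ => basisFun S j x * chebProd L r x * basisFun S k x := by
  simp only [basisFun_mul_chebProd_mul hS]
  exact Integrable.fintype_prod fun l =>
    ((integrable_eval_mul_exp (entryPoly (S * L) (r l) (j l) (k l))).comp_mul_left'
      hS.ne').const_mul S

theorem integral_basisFun_mul_chebProd_mul {N : ℕ} {S L : ℝ} (hS : 0 < S)
    (r j k : Fin N → ℕ) :
    ∫ x : Fin N → ℝ, basisFun S j x * chebProd L r x * basisFun S k x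
      = ∏ l, gaussInt (entryPoly (S * L) (r l) (j l) (k l)) := by
  simp only [basisFun_mul_chebProd_mul hS]
  rw [integral_fintype_prod_volume_eq_prod fun l (x : ℝ) =>
    S * ((entryPoly (S * L) (r l) (j l) (k l)).eval (S * x) * Real.exp (-(S * x) ^ 2))]
  refine Finset.prod_congr rfl fun l _ => ?_
  rw [integral_const_mul, Measure.integral_comp_mul_left
    (fun y : ℝ => (entryPoly (S * L) (r l) (j l) (k l)).eval y * Real.exp (-y ^ 2)),
    abs_of_pos (inv_pos.2 hS), smul_eq_mul, mul_inv_cancel_left₀ hS.ne', gaussInt]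

theorem ghQuad_basisFun_mul_chebProd_mul {N : ℕ} {S L : ℝ} (hS : 0 < S) (M : ℕ)
    (r j k : Fin N → ℕ) :
    ghQuad S M (fun x => basisFun S j x * chebProd L r x * basisFun S k x)
      = ∏ l, gaussQuad M (entryPoly (S * L) (r l) (j l) (k l)) := by
  simp only [ghQuad, gaussQuad, basisFun_mul_chebProd_mul hS, ← Finset.prod_mul_distrib]
  rw [← Finset.sum_prod_piFinset]
  refine Finset.sum_congr rfl fun ξ _ => Finset.prod_congr rfl fun l _ => ?_
  rw [mul_div_cancel₀ _ hS.ne', Real.exp_neg]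
  field_simp

theorem galerkinMatrix_sub_apply {N : ℕ} {S L : ℝ} (hS : 0 < S) (K : ℕ)
    (I : Finset (Fin N → ℕ)) (node : I → Fin N → ℝ) (f : (Fin N → ℝ) → ℝ)
    (j k : hyperbolicCross N K) :
    (galerkinMatrix S K (chebInterp L I node f) - ghGalerkinMatrix S K (chebInterp L I node f)) j k
      = ((∑ r : I, chebCoeff L I node f r *
          (∏ l, gaussInt (entryPoly (S * L) (r.1 l) (j.1 l) (k.1 l))
            - ∏ l, gaussQuad K (entryPoly (S * L) (r.1 l) (j.1 l) (k.1 l))) : ℝ) : ℂ) := by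
  have e : ∀ x, basisFun S j.1 x * chebInterp L I node f x * basisFun S k.1 x
      = ∑ r : I, chebCoeff L I node f r *
          (basisFun S j.1 x * chebProd L r.1 x * basisFun S k.1 x) := by
    intro x
    rw [chebInterp, Finset.mul_sum, Finset.sum_mul]
    exact Finset.sum_congr rfl fun r _ => by ring
  rw [Matrix.sub_apply, galerkinMatrix, ghGalerkinMatrix, Matrix.of_apply, Matrix.of_apply,
    ← Complex.ofReal_sub]
  congr 1
  simp only [e, mul_sub, Finset.sum_sub_distrib]
  congr 1
  · rw [integral_finsetSum _ fun r _ =>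
      (integrable_basisFun_mul_chebProd_mul hS r.1 j.1 k.1).const_mul _]
    simp only [integral_const_mul, integral_basisFun_mul_chebProd_mul hS]
  · simp only [← ghQuad_basisFun_mul_chebProd_mul hS]
    simp only [ghQuad, Finset.mul_sum]
    rw [Finset.sum_comm]
    exact Finset.sum_congr rfl fun r _ => Finset.sum_congr rfl fun ξ _ => by ring

/-! ### Counting the inexact entries -/

theorem hyperbolicCross_apply_le {N K : ℕ} {k : Fin N → ℕ} (hk : k ∈ hyperbolicCross N K)
    (l : Fin N) : k l ≤ K := by
  rw [hyperbolicCross, Finset.mem_filter, Fintype.mem_piFinset] at hk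
  have := Finset.mem_range.1 (hk.1 l)
  omega

/-- A member of the hyperbolic cross with one large component is supported there. -/
theorem hyperbolicCross_apply_eq_zero {N K : ℕ} {k : Fin N → ℕ} (hk : k ∈ hyperbolicCross N K)
    {l l' : Fin N} (hl : K + 1 < 2 * (1 + k l)) (hne : l' ≠ l) : k l' = 0 := by
  by_contra h0
  have h1 : (1 + k l) * (1 + k l') ≤ ∏ i, (1 + k i) := by
    rw [← Finset.prod_pair (f := fun i => 1 + k i) hne.symm]
    exact Finset.prod_le_prod_of_subset_of_one_le' (Finset.subset_univ _) fun i _ _ => by omega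
  have h2 : (1 + k l) * 2 ≤ (1 + k l) * (1 + k l') := Nat.mul_le_mul_left _ (by omega)
  have h3 := mem_hyperbolicCross.1 hk
  omega

/-- The indices `k` for which the quadrature of the `(j, k)` entry of `T_r` may be inexact. -/
def inexactIndices {N : ℕ} (K : ℕ) (r j : Fin N → ℕ) : Finset (hyperbolicCross N K) :=
  Finset.univ.filter fun k => ∃ l, 2 * K + 2 ≤ j l + r l + k.1 l

/-- Inexactness in direction `l` forces `j l` and `k l` to be at least `K + 2 - r l`, more than half
of `K`. So `j` fixes the direction, and `k` is determined by one component in `[K + 2 - rMax r, K]`.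
-/
theorem card_inexactIndices_le {N K R : ℕ} {r j : Fin N → ℕ} (hr : ∀ l, r l ≤ R)
    (hK : 2 * R ≤ K) (hj : j ∈ hyperbolicCross N K) :
    (inexactIndices K r j).card ≤ rMax r - 1 := by
  have hrl : ∀ l, r l ≤ rMax r := fun l => Finset.le_sup (f := r) (Finset.mem_univ l)
  rcases (inexactIndices K r j).eq_empty_or_nonempty with h | ⟨k₀, hk₀⟩
  · rw [h, Finset.card_empty]
    exact Nat.zero_le _
  obtain ⟨l₀, hl₀⟩ := (Finset.mem_filter.1 hk₀).2
  have hmem : ∀ k ∈ inexactIndices K r j,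
      2 * K + 2 ≤ j l₀ + r l₀ + k.1 l₀ ∧ ∀ l, l ≠ l₀ → k.1 l = 0 := by
    intro k hk
    obtain ⟨l, hl⟩ := (Finset.mem_filter.1 hk).2
    -- In any other direction `j l = 0`, leaving `r l + k l ≤ R + K < 2K + 2`.
    have hll : l = l₀ := by
      by_contra hne
      have h1 := hyperbolicCross_apply_le k₀.2 l₀
      have h2 := hyperbolicCross_apply_le k.2 l
      have h3 := hr l₀
      have h4 := hr l
      have h5 : j l = 0 := hyperbolicCross_apply_eq_zero hj (l := l₀) (by omega) hne
      omega
    subst hll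
    have h1 := hyperbolicCross_apply_le hj l
    have h2 := hr l
    exact ⟨hl, fun l' hne => hyperbolicCross_apply_eq_zero k.2 (l := l) (by omega) hne⟩
  have hcard : (Finset.Icc (K + 2 - rMax r) K).card ≤ rMax r - 1 := by
    rw [Nat.card_Icc]
    omega
  refine (Finset.card_le_card_of_injOn (fun k => k.1 l₀) (fun k hk => ?_) ?_).trans hcard
  · have h1 := (hmem k hk).1
    have h2 := hyperbolicCross_apply_le k.2 l₀
    have h3 := hyperbolicCross_apply_le hj l₀
    have h4 := hrl l₀
    simp only [Finset.coe_Icc, Set.mem_Icc]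
    omega
  · intro k hk k' hk' heq
    refine Subtype.ext (funext fun l => ?_)
    rcases eq_or_ne l l₀ with rfl | hne
    · exact heq
    · rw [(hmem k hk).2 l hne, (hmem k' hk').2 l hne]

/-! ### Elementary estimates for constants and decay -/

/-- The summand of `quadConst`. -/
def quadWeight {N : ℕ} (r : Fin N → ℕ) : ℝ :=
  (1 / 4) * (rMax r : ℝ) ^ 2 * ((rMax r : ℝ) - 1) * (Nat.choose (rMax r) (rMax r / 2 - 1) : ℝ)

/-- Both sides vanish for `rMax r ≤ 1`; otherwise `rMax² / 4` and the binomial coefficient are at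
least one. -/
theorem rMax_sub_one_le_quadWeight {N : ℕ} (r : Fin N → ℕ) :
    ((rMax r - 1 : ℕ) : ℝ) ≤ quadWeight r := by
  rw [quadWeight]
  generalize rMax r = ρ
  match ρ with
  | 0 => simp
  | 1 => simp
  | n + 2 =>
    have hc : (1 : ℝ) ≤ (Nat.choose (n + 2) ((n + 2) / 2 - 1) : ℝ) := by
      exact_mod_cast Nat.choose_pos (by omega)
    have hn : (0 : ℝ) ≤ n := n.cast_nonneg
    have h1 : ((n + 2 - 1 : ℕ) : ℝ) = n + 1 := by
      rw [show n + 2 - 1 = n + 1 by omega]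
      push_cast
      ring
    have h2 : (1 : ℝ) ≤ 1 / 4 * ((n : ℝ) + 2) ^ 2 := by nlinarith
    have h3 : ((n : ℝ) + 2 - 1) = n + 1 := by ring
    rw [h1]
    push_cast
    rw [h3]
    calc (n : ℝ) + 1 = 1 * (n + 1) * 1 := by ring
      _ ≤ _ := by gcongr

theorem abs_prod_le_one {N : ℕ} {a : Fin N → ℝ} (h : ∀ l, |a l| ≤ 1) : |∏ l, a l| ≤ 1 := by
  rw [Finset.abs_prod]
  exact Finset.prod_le_one (fun l _ => abs_nonneg _) fun l _ => h l

theorem zpow_neg_le_two_pow_mul {K R m : ℕ} (β : ℕ) (hK : 2 * R ≤ K) (hK0 : 0 < K)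
    (hm : K ≤ m + R) : (m : ℝ) ^ (-(β : ℤ)) ≤ 2 ^ β * (K : ℝ) ^ (-(β : ℤ)) := by
  have hKr : (0 : ℝ) < K := by exact_mod_cast hK0
  have h1 : (K : ℝ) / 2 ≤ m := by
    have : (K : ℝ) ≤ m * 2 := by exact_mod_cast (by omega : K ≤ m * 2)
    linarith
  rw [zpow_neg, zpow_neg, zpow_natCast, zpow_natCast]
  calc ((m : ℝ) ^ β)⁻¹ ≤ (((K : ℝ) / 2) ^ β)⁻¹ := by gcongr
    _ = 2 ^ β * ((K : ℝ) ^ β)⁻¹ := by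
      rw [div_pow, inv_div]
      ring

/-- Bernoulli's inequality: `(1 - R/K)^β ≥ 1 - βR/K ≥ 1/2`. This is what removes the factor `2 ^ β`.
-/
theorem zpow_neg_le_two_mul {K R m : ℕ} (β : ℕ) (hK : 2 * R * β ≤ K) (hRK : R < K)
    (hm : K ≤ m + R) : (m : ℝ) ^ (-(β : ℤ)) ≤ 2 * (K : ℝ) ^ (-(β : ℤ)) := by
  have hK0 : (0 : ℝ) < K := by exact_mod_cast (by omega : 0 < K)
  have hRK' : (R : ℝ) < K := by exact_mod_cast hRK
  have hm' : (K : ℝ) - R ≤ m := by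
    have : (K : ℝ) ≤ m + R := by exact_mod_cast hm
    linarith
  have hβ : (β : ℝ) * (R / K) ≤ 1 / 2 := by
    have : (2 : ℝ) * R * β ≤ K := by exact_mod_cast hK
    rw [← mul_div_assoc, div_le_iff₀ hK0]
    linarith
  have hb := one_add_mul_le_pow (a := -((R : ℝ) / K)) (by
    have : (R : ℝ) / K ≤ 1 := (div_le_one hK0).2 hRK'.le
    linarith) β
  have h1 : (K : ℝ) ^ β / 2 ≤ (m : ℝ) ^ β := by
    calc (K : ℝ) ^ β / 2 = (K : ℝ) ^ β * (1 / 2) := by ring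
      _ ≤ (K : ℝ) ^ β * (1 + -((R : ℝ) / K)) ^ β := by
        gcongr
        linarith
      _ = ((K : ℝ) - R) ^ β := by
        rw [← mul_pow]
        congr 1
        field_simp
        ring
      _ ≤ (m : ℝ) ^ β := by
        have : (0 : ℝ) ≤ (K : ℝ) - R := by linarith
        gcongr
  rw [zpow_neg, zpow_neg, zpow_natCast, zpow_natCast]
  calc ((m : ℝ) ^ β)⁻¹ ≤ ((K : ℝ) ^ β / 2)⁻¹ := by gcongr
    _ = 2 * ((K : ℝ) ^ β)⁻¹ := by
      rw [inv_div]
      ring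

theorem prod_max_zpow_le {N : ℕ} (k : Fin N → ℕ) (β : ℕ) {l : Fin N} (hl : 0 < k l) :
    ∏ i, ((max (k i) 1 : ℕ) : ℝ) ^ (-(β : ℤ)) ≤ (k l : ℝ) ^ (-(β : ℤ)) := by
  have h0 : ∀ i, (0 : ℝ) ≤ ((max (k i) 1 : ℕ) : ℝ) ^ (-(β : ℤ)) := fun i => by positivity
  have h1 : ∀ i, ((max (k i) 1 : ℕ) : ℝ) ^ (-(β : ℤ)) ≤ 1 := fun i => by
    rw [zpow_neg, zpow_natCast]
    exact inv_le_one_of_one_le₀ (one_le_pow₀ (by exact_mod_cast le_max_right _ _))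
  rw [← Finset.mul_prod_erase _ _ (Finset.mem_univ l), max_eq_left (by omega : 1 ≤ k l)]
  exact mul_le_of_le_one_right (by positivity) (Finset.prod_le_one (fun i _ => h0 i) fun i _ => h1 i)

/-! ### Assembly of the error bound -/

/-- The error bound for a coefficient vector whose components near the boundary of the cross are
at most `B`. -/
theorem norm_mulVec_sub_le {N K R : ℕ} {I : Finset (Fin N → ℕ)} (hI : ∀ r ∈ I, ∀ l, r l ≤ R)
    {L S B : ℝ} (hS : 0 < S) (hB : 0 ≤ B) (hR : R ^ 2 ≤ K) (hR' : 2 * R ≤ K)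
    (hSL : Real.sqrt (2 * ((K : ℝ) + 1)) + 1 ≤ S * L) (node : I → Fin N → ℝ)
    (f : (Fin N → ℝ) → ℝ) (v : hyperbolicCross N K → ℂ)
    (hv : ∀ k : hyperbolicCross N K, ∀ l, K + 2 ≤ k.1 l + R → ‖v k‖ ≤ B)
    (j : hyperbolicCross N K) :
    ‖((galerkinMatrix S K (chebInterp L I node f)
        - ghGalerkinMatrix S K (chebInterp L I node f)).mulVec v) j‖
      ≤ 2 * B * quadConst I (chebCoeff L I node f) := by
  set D : I → hyperbolicCross N K → ℝ := fun r k =>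
    ∏ l, gaussInt (entryPoly (S * L) (r.1 l) (j.1 l) (k.1 l))
      - ∏ l, gaussQuad K (entryPoly (S * L) (r.1 l) (j.1 l) (k.1 l)) with hD
  have hpos : 0 < S * L := by
    have := Real.sqrt_nonneg (2 * ((K : ℝ) + 1))
    linarith
  have hD2 : ∀ r k, |D r k| ≤ 2 := by
    intro r k
    have h1 := abs_prod_le_one fun l => abs_gaussInt_entryPoly_le_one hR hSL (hI r.1 r.2 l)
      (hyperbolicCross_apply_le j.2 l) (hyperbolicCross_apply_le k.2 l)
    have h2 := abs_prod_le_one fun l => abs_gaussQuad_entryPoly_le_one (r := r.1 l) hpos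
      ((le_add_of_nonneg_right zero_le_one).trans hSL)
      (hyperbolicCross_apply_le j.2 l) (hyperbolicCross_apply_le k.2 l)
    exact (abs_sub _ _).trans (by linarith)
  have hD0 : ∀ r k, k ∉ inexactIndices K r.1 j.1 → D r k = 0 := by
    intro r k hk
    have hk' : ∀ l, j.1 l + r.1 l + k.1 l < 2 * K + 2 := by
      simpa [inexactIndices] using hk
    refine sub_eq_zero.2 (Finset.prod_congr rfl fun l _ => gaussInt_eq_gaussQuad ?_)
    have h1 := natDegree_entryPoly_le (S * L) (r.1 l) (j.1 l) (k.1 l)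
    have h2 := hk' l
    omega
  have hsum : ∀ r, ∑ k, |D r k| * ‖v k‖ ≤ 2 * B * quadWeight r.1 := by
    intro r
    have h1 : ∑ k, |D r k| * ‖v k‖ = ∑ k ∈ inexactIndices K r.1 j.1, |D r k| * ‖v k‖ :=
      (Finset.sum_subset (Finset.subset_univ _) fun k _ hk => by
        rw [hD0 r k hk, abs_zero, zero_mul]).symm
    have h2 : ∀ k ∈ inexactIndices K r.1 j.1, |D r k| * ‖v k‖ ≤ 2 * B := by
      intro k hk
      obtain ⟨l, hl⟩ := (Finset.mem_filter.1 hk).2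
      have hj := hyperbolicCross_apply_le j.2 l
      have hrl := hI r.1 r.2 l
      exact mul_le_mul (hD2 r k) (hv k l (by omega)) (norm_nonneg _) zero_le_two
    rw [h1]
    refine (Finset.sum_le_card_nsmul _ _ _ h2).trans ?_
    rw [nsmul_eq_mul, mul_comm]
    refine mul_le_mul_of_nonneg_left ?_ (by positivity)
    exact (Nat.cast_le.2 (card_inexactIndices_le (hI r.1 r.2) hR' j.2)).trans
      (rMax_sub_one_le_quadWeight r.1)
  calc ‖((galerkinMatrix S K (chebInterp L I node f)
        - ghGalerkinMatrix S K (chebInterp L I node f)).mulVec v) j‖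
      = ‖∑ k, ((∑ r : I, chebCoeff L I node f r * D r k : ℝ) : ℂ) * v k‖ := by
        simp only [Matrix.mulVec, dotProduct, galerkinMatrix_sub_apply hS, hD]
    _ ≤ ∑ k, ∑ r : I, |chebCoeff L I node f r| * (|D r k| * ‖v k‖) := by
        refine (norm_sum_le _ _).trans (Finset.sum_le_sum fun k _ => ?_)
        rw [norm_mul, Complex.norm_real, Real.norm_eq_abs]
        refine (mul_le_mul_of_nonneg_right (Finset.abs_sum_le_sum_abs _ _)
          (norm_nonneg _)).trans_eq ?_
        rw [Finset.sum_mul]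
        exact Finset.sum_congr rfl fun r _ => by rw [abs_mul, mul_assoc]
    _ = ∑ r : I, |chebCoeff L I node f r| * ∑ k, |D r k| * ‖v k‖ := by
        rw [Finset.sum_comm]
        simp only [Finset.mul_sum]
    _ ≤ ∑ r : I, |chebCoeff L I node f r| * (2 * B * quadWeight r.1) :=
        Finset.sum_le_sum fun r _ => mul_le_mul_of_nonneg_left (hsum r) (abs_nonneg _)
    _ = 2 * B * quadConst I (chebCoeff L I node f) := by
        rw [quadConst, Finset.mul_sum]
        exact Finset.sum_congr rfl fun r _ => by
          rw [quadWeight]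
          ring

end HermiteGalerkin

end

theorem mainTheorem1 :
    ∃ c : ℝ, 0 < c ∧ ∀ R : ℕ, ∃ K₀ : ℕ,
      ∀ (N : ℕ) (I : Finset (Fin N → ℕ)), (∀ r ∈ I, ∀ l, r l ≤ R) →
      ∀ (L : ℝ), 0 < L →
      ∀ (node : I → Fin N → ℝ), (∀ s l, node s l ∈ Set.Icc (-L) L) →
        IsUnit (HermiteGalerkin.collocation L I node).det →
      ∀ (W : (Fin N → ℝ) → ℝ → ℝ) (t : ℝ) (β K : ℕ), K₀ ≤ K →
      ∀ (S : ℝ), 0 < S → Real.sqrt (2 * ((K : ℝ) + 1)) + 1 ≤ S * L →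
      ∀ (A : ℝ) (v : HermiteGalerkin.hyperbolicCross N K → ℂ),
        (∀ k, ‖v k‖ ≤ A * ∏ l, ((max (k.1 l) 1 : ℕ) : ℝ) ^ (-(β : ℤ))) →
      ∀ j : HermiteGalerkin.hyperbolicCross N K,
        ‖((HermiteGalerkin.galerkinMatrix S K
              (HermiteGalerkin.chebInterp L I node fun x => W x t)
            - HermiteGalerkin.ghGalerkinMatrix S K
              (HermiteGalerkin.chebInterp L I node fun x => W x t)).mulVec v) j‖
          ≤ 2 ^ β * c * A
              * HermiteGalerkin.quadConst I (HermiteGalerkin.chebCoeff L I node fun x => W x t)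
              * (K : ℝ) ^ (-(β : ℤ)) ∧
        (K₀ * β ≤ K →
          ‖((HermiteGalerkin.galerkinMatrix S K
                (HermiteGalerkin.chebInterp L I node fun x => W x t)
              - HermiteGalerkin.ghGalerkinMatrix S K
                (HermiteGalerkin.chebInterp L I node fun x => W x t)).mulVec v) j‖
            ≤ c * A
                * HermiteGalerkin.quadConst I
                    (HermiteGalerkin.chebCoeff L I node fun x => W x t)
                * (K : ℝ) ^ (-(β : ℤ))) := by
  -- One factor 2 of `c` bounds the difference of products, the other comes from Bernoulli. In `K₀`,
  -- `R ^ 2` serves the node radius, `2 * R` the localization and decay bounds, and `1` makes `K`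
  -- positive and larger than `R`.
  refine ⟨4, by norm_num, fun R => ⟨R ^ 2 + 2 * R + 1, ?_⟩⟩
  intro N I hI L _ node _ _ W t β K hK S hS hSL A v hv j
  -- The decay bound at the index `j` itself forces the sign of `A`.
  have hA : 0 ≤ A := by
    have hpos : 0 < ∏ l, ((max (j.1 l) 1 : ℕ) : ℝ) ^ (-(β : ℤ)) :=
      Finset.prod_pos fun l _ => by positivity
    exact nonneg_of_mul_nonneg_left ((norm_nonneg _).trans (hv j)) hpos
  have hQ : 0 ≤ HermiteGalerkin.quadConst I
      (HermiteGalerkin.chebCoeff L I node fun x => W x t) :=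
    Finset.sum_nonneg fun r _ => mul_nonneg (abs_nonneg _)
      ((Nat.cast_nonneg _).trans (HermiteGalerkin.rMax_sub_one_le_quadWeight r.1))
  have key : ∀ b : ℝ, 0 ≤ b → (∀ m : ℕ, K ≤ m + R → (m : ℝ) ^ (-(β : ℤ)) ≤ b) →
      ‖((HermiteGalerkin.galerkinMatrix S K
            (HermiteGalerkin.chebInterp L I node fun x => W x t)
          - HermiteGalerkin.ghGalerkinMatrix S K
            (HermiteGalerkin.chebInterp L I node fun x => W x t)).mulVec v) j‖
        ≤ 2 * (A * b) * HermiteGalerkin.quadConst I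
            (HermiteGalerkin.chebCoeff L I node fun x => W x t) := by
    intro b hb hm
    refine HermiteGalerkin.norm_mulVec_sub_le hI hS (mul_nonneg hA hb) (by omega) (by omega) hSL
      node _ v (fun k l hl => ?_) j
    exact (hv k).trans (mul_le_mul_of_nonneg_left
      ((HermiteGalerkin.prod_max_zpow_le k.1 β (l := l) (by omega)).trans (hm _ (by omega))) hA)
  have hKz : (0 : ℝ) ≤ (K : ℝ) ^ (-(β : ℤ)) := by positivity
  refine ⟨?_, fun hKβ => ?_⟩
  · refine (key (2 ^ β * (K : ℝ) ^ (-(β : ℤ))) (by positivity) fun m hm =>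
      HermiteGalerkin.zpow_neg_le_two_pow_mul β (by omega) (by omega) hm).trans ?_
    have : 0 ≤ 2 ^ β * A * HermiteGalerkin.quadConst I
        (HermiteGalerkin.chebCoeff L I node fun x => W x t) * (K : ℝ) ^ (-(β : ℤ)) := by
      positivity
    linarith
  · have hRβ : 2 * R * β ≤ K :=
      (Nat.mul_le_mul_right β (by omega)).trans hKβ
    refine (key (2 * (K : ℝ) ^ (-(β : ℤ))) (by positivity) fun m hm =>
      HermiteGalerkin.zpow_neg_le_two_mul β hRβ (by omega) hm).trans (le_of_eq ?_)
    ring
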